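/- Let $F$ be a nonarchimedean local field with ring of integers $\mathcal R$, maximal ideal $\mathcal P$, uniformizer $\varpi$ and residue field $\mathfrak f=\mathcal R/\mathcal P\cong\mathbb F_2$. Put $\mathcal K'=\mathrm{SL}(2,\mathcal R)$ and, for $\ell\ge 1$, let $B'_\ell\subset\mathcal K'$ be the subgroup of matrices that are lower triangular modulo $\mathcal P^\ell$, and let $g_\ell=\mathrm{diag}(\varpi^\ell,1)\in\mathrm{GL}(2,F)$. Let $\sigma$ be a cuspidal complex representation of $\mathrm{SL}(2,\mathfrak f)$ (irreducible, without nonzero vectors fixed by the unipotent radical of a Borel subgroup), inflated to $\mathcal K'$ through reduction modulo $\mathcal P$, let ${}^{g_\ell}\sigma$ be the representation $h\mapsto\sigma(g_\ell^{-1}hg_\ell)$ of $B'_\ell$, and let $$\sigma(\ell)=\mathrm{Ind}_{B'_\ell}^{\mathcal K'}\,{}^{g_\ell}\sigma$$ be the smoothly induced representation, that is, the space of locally constant functions $f$ on $\mathcal K'$ with $f(hk)={}^{g_\ell}\sigma(h)f(k)$ for $h\in B'_\ell$, $k\in\mathcal K'$, on which $\mathcal K'$ acts by right translation. Then, for every $\ell\ge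 1$, the Mackey component $\sigma(\ell)$ is multiplicity-free: $\dim\mathrm{Hom}_{\mathcal K'}(\tau,\sigma(\ell))\le 1$ for every irreducible representation $\tau$ of $\mathcal K'$. Moreover the algebra $\mathrm{End}_{\mathcal K'}(\sigma(\ell))$ is finite-dimensional and commutative, and $\sigma(\ell)$ is the direct sum of exactly $\Sigma(\ell):=\dim\mathrm{End}_{\mathcal K'}(\sigma(\ell))$ irreducible subrepresentations, no two of which are isomorphic. -/

import Mathlib

universe v

namespace MackeySL2

noncomputable section

/-! ### The subgroup `B'_ℓ` of `SL(2, R)` and conjugation by `g_ℓ = diag(ϖ ^ ℓ, 1)` -/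

section Groups

/-- The subgroup `B'_ℓ` of `SL(2, R)` of the matrices that are lower triangular modulo the `ℓ`-th
power of the maximal ideal of `R`. -/
def lowerBorel (R : Type*) [CommRing R] [IsLocalRing R] (ℓ : ℕ) :
    Subgroup (Matrix.SpecialLinearGroup (Fin 2) R) where
  carrier := {g | g 0 1 ∈ IsLocalRing.maximalIdeal R ^ ℓ}
  one_mem' := by simp
  mul_mem' := by
    intro a b ha hb
    simp only [Set.mem_ofPred_eq, Matrix.SpecialLinearGroup.coe_mul, Matrix.mul_apply,
      Fin.sum_univ_two] at ha hb ⊢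
    exact Ideal.add_mem _ (Ideal.mul_mem_left _ _ hb) (Ideal.mul_mem_right _ _ ha)
  inv_mem' := by
    intro a ha
    simp only [Set.mem_ofPred_eq, Matrix.SpecialLinearGroup.coe_inv, Matrix.adjugate_fin_two] at ha ⊢
    simpa using ha

variable {R : Type*} [CommRing R] [IsDomain R] [IsDiscreteValuationRing R]

theorem exists_eq_pow_mul {ϖ : R} (hϖ : Irreducible ϖ) {ℓ : ℕ} (h : lowerBorel R ℓ) :
    ∃ b : R, h.1 0 1 = ϖ ^ ℓ * b := by
  have h1 : h.1 0 1 ∈ IsLocalRing.maximalIdeal R ^ ℓ := h.2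
  rw [hϖ.maximalIdeal_eq, Ideal.span_singleton_pow, Ideal.mem_span_singleton] at h1
  exact h1

/-- For `h ∈ B'_ℓ`, the quotient by `ϖ ^ ℓ` of the upper right entry of `h`. -/
def upperQuot {ϖ : R} (hϖ : Irreducible ϖ) {ℓ : ℕ} (h : lowerBorel R ℓ) : R :=
  (exists_eq_pow_mul hϖ h).choose

theorem pow_mul_upperQuot {ϖ : R} (hϖ : Irreducible ϖ) {ℓ : ℕ} (h : lowerBorel R ℓ) :
    h.1 0 1 = ϖ ^ ℓ * upperQuot hϖ h :=
  (exists_eq_pow_mul hϖ h).choose_spec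

theorem upperQuot_eq {ϖ : R} (hϖ : Irreducible ϖ) {ℓ : ℕ} (h : lowerBorel R ℓ) {b : R}
    (hb : h.1 0 1 = ϖ ^ ℓ * b) : upperQuot hϖ h = b :=
  mul_left_cancel₀ (pow_ne_zero ℓ hϖ.ne_zero) (by rw [← pow_mul_upperQuot, hb])

/-- The homomorphism `h ↦ g_ℓ⁻¹ * h * g_ℓ` from `B'_ℓ` to `SL(2, R)`, where
`g_ℓ = diag(ϖ ^ ℓ, 1)` and `ϖ` is a uniformizer of `R`. The theorem `mapGL_conjDiag` below
identifies it with conjugation in `GL(2, F)`, `F` being the fraction field of `R`. -/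
def conjDiag {ϖ : R} (hϖ : Irreducible ϖ) (ℓ : ℕ) :
    lowerBorel R ℓ →* Matrix.SpecialLinearGroup (Fin 2) R where
  toFun h := ⟨!![h.1 0 0, upperQuot hϖ h; h.1 1 0 * ϖ ^ ℓ, h.1 1 1], by
    have hd := h.1.det_coe
    rw [Matrix.det_fin_two, pow_mul_upperQuot hϖ h] at hd
    rw [Matrix.det_fin_two_of]
    linear_combination hd⟩
  map_one' := by
    have h0 : upperQuot hϖ (1 : lowerBorel R ℓ) = 0 := upperQuot_eq hϖ _ (by simp)
    ext i j
    fin_cases i <;> fin_cases j <;> simp [h0]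
  map_mul' x y := by
    have hx := pow_mul_upperQuot hϖ x
    have hy := pow_mul_upperQuot hϖ y
    have hc : upperQuot hϖ (x * y) = x.1 0 0 * upperQuot hϖ y + upperQuot hϖ x * y.1 1 1 := by
      apply upperQuot_eq
      simp only [Subgroup.coe_mul, Matrix.SpecialLinearGroup.coe_mul, Matrix.mul_apply,
        Fin.sum_univ_two, hx, hy]
      ring
    apply Subtype.ext
    change !![(x * y).1 0 0, upperQuot hϖ (x * y); (x * y).1 1 0 * ϖ ^ ℓ, (x * y).1 1 1] =
      !![x.1 0 0, upperQuot hϖ x; x.1 1 0 * ϖ ^ ℓ, x.1 1 1] *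
        !![y.1 0 0, upperQuot hϖ y; y.1 1 0 * ϖ ^ ℓ, y.1 1 1]
    ext i j
    fin_cases i <;> fin_cases j <;>
      simp [Matrix.mul_apply, Fin.sum_univ_two, hx, hy, hc] <;> ring

theorem coe_conjDiag {ϖ : R} (hϖ : Irreducible ϖ) (ℓ : ℕ) (h : lowerBorel R ℓ) :
    (conjDiag hϖ ℓ h : Matrix (Fin 2) (Fin 2) R) =
      !![h.1 0 0, upperQuot hϖ h; h.1 1 0 * ϖ ^ ℓ, h.1 1 1] := rfl

/-- The matrix `g_ℓ = diag(ϖ ^ ℓ, 1)` of `GL(2, F)`. -/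
def diagGL (F : Type*) [Field F] [Algebra R F] [IsFractionRing R F] {ϖ : R}
    (hϖ : Irreducible ϖ) (ℓ : ℕ) : GL (Fin 2) F :=
  Matrix.GeneralLinearGroup.mkOfDetNeZero !![algebraMap R F ϖ ^ ℓ, 0; 0, 1] (by
    rw [Matrix.det_fin_two_of]
    simpa using pow_ne_zero ℓ (mt (IsFractionRing.to_map_eq_zero_iff (K := F)).1 hϖ.ne_zero))

theorem mapGL_conjDiag (F : Type*) [Field F] [Algebra R F] [IsFractionRing R F] {ϖ : R}
    (hϖ : Irreducible ϖ) (ℓ : ℕ) (h : lowerBorel R ℓ) :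
    Matrix.SpecialLinearGroup.mapGL F (conjDiag hϖ ℓ h) =
      (diagGL F hϖ ℓ)⁻¹ * Matrix.SpecialLinearGroup.mapGL F h.1 * diagGL F hϖ ℓ := by
  have hb := pow_mul_upperQuot hϖ h
  rw [mul_assoc, eq_inv_mul_iff_mul_eq]
  ext i j
  fin_cases i <;> fin_cases j
  all_goals simp [coe_conjDiag, diagGL, Matrix.GeneralLinearGroup.mkOfDetNeZero, Matrix.mul_apply,
    Fin.sum_univ_two, hb, mul_comm]

end Groups

/-! ### Representation theory -/

section Representations

/-- A complex representation of `SL(2, k)`, `k` a finite field, is cuspidal if it is irreducible and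
has no nonzero vector that is fixed by the unipotent radical of a Borel subgroup (all Borel
subgroups being conjugate, the upper triangular one suffices). -/
def IsCuspidal {k : Type*} [Field k] {V : Type*} [AddCommGroup V] [Module ℂ V]
    (σ : Representation ℂ (Matrix.SpecialLinearGroup (Fin 2) k) V) : Prop :=
  σ.IsIrreducible ∧
    ∀ v : V, (∀ x : k, σ ⟨!![1, x; 0, 1], by simp⟩ v = v) → v = 0

variable {G : Type*} [Group G] [TopologicalSpace G] [ContinuousMul G]
variable {V : Type*} [AddCommGroup V] [Module ℂ V]

/-- The space of the representation of a compact group `G` smoothly induced from a representation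
`τ` of a subgroup `H`: the locally constant functions `f : G → V` such that
`f (h * g) = τ h (f g)` for all `h ∈ H` and `g ∈ G`. (There is no condition on supports, because
`G` is compact.) -/
def smoothIndSpace (H : Subgroup G) (τ : Representation ℂ H V) : Submodule ℂ (G → V) where
  carrier := {f | (∀ (h : H) (g : G), f (h * g) = τ h (f g)) ∧ IsLocallyConstant f}
  zero_mem' := ⟨by simp, IsLocallyConstant.const 0⟩
  add_mem' := fun ha hb =>
    ⟨fun h g => by simp [ha.1 h g, hb.1 h g], ha.2.add hb.2⟩
  smul_mem' := fun c _ ha =>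
    ⟨fun h g => by simp [ha.1 h g], ha.2.comp (fun v => c • v)⟩

/-- The smoothly induced representation of the compact group `G`: the group acts by right
translation, `(g • f) x = f (x * g)`. -/
def smoothInd (H : Subgroup G) (τ : Representation ℂ H V) :
    Representation ℂ G (smoothIndSpace H τ) where
  toFun g := (LinearMap.funLeft ℂ V (fun x : G => x * g)).restrict fun f hf =>
    ⟨fun h x => by simpa [LinearMap.funLeft_apply, mul_assoc] using hf.1 h (x * g),
      hf.2.comp_continuous (continuous_mul_const g)⟩
  map_one' := by
    ext f x
    exact congrArg f.1 (mul_one x)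
  map_mul' a b := by
    ext f x
    exact congrArg f.1 (mul_assoc x a b).symm

/-- A representation `π` is multiplicity-free if every irreducible representation `τ` occurs in it
at most once, that is, `dim Hom_G(τ, π) ≤ 1`. -/
def IsMultiplicityFree {G : Type*} [Group G] {V : Type v} [AddCommGroup V] [Module ℂ V]
    (π : Representation ℂ G V) : Prop :=
  ∀ (W : Type v) [AddCommGroup W] [Module ℂ W] (τ : Representation ℂ G W),
    τ.IsIrreducible → Module.rank ℂ (Representation.IntertwiningMap τ π) ≤ 1

/-- The self-intertwining number `dim End_G(π)`. -/
def selfIntertwiningNumber {G : Type*} [Group G] {V : Type*} [AddCommGroup V] [Module ℂ V]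
    (π : Representation ℂ G V) : ℕ :=
  Module.finrank ℂ (Representation.IntertwiningMap π π)

/-- `π` is the internal direct sum of `n` irreducible subrepresentations, no two of which are
isomorphic. -/
def IsSumOfDistinctIrreducibles {G : Type*} [Group G] {V : Type*} [AddCommGroup V] [Module ℂ V]
    (π : Representation ℂ G V) (n : ℕ) : Prop :=
  ∃ W : Fin n → Subrepresentation π,
    (∀ i, (W i).toRepresentation.IsIrreducible) ∧
    (∀ i j, i ≠ j →
      IsEmpty (Representation.Equiv (W i).toRepresentation (W j).toRepresentation)) ∧
    DirectSum.IsInternal fun i => (W i).toSubmodule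

end Representations

/-! ### The Mackey components -/

section Mackey

variable {R : Type*} [CommRing R] [IsDomain R] [IsDiscreteValuationRing R]
variable {V : Type*} [AddCommGroup V] [Module ℂ V]

/-- The inflation to `SL(2, R)` of a representation of `SL(2, k)`, `k` the residue field of `R`. -/
def inflation
    (σ : Representation ℂ (Matrix.SpecialLinearGroup (Fin 2) (IsLocalRing.ResidueField R)) V) :
    Representation ℂ (Matrix.SpecialLinearGroup (Fin 2) R) V :=
  σ.comp (Matrix.SpecialLinearGroup.map (IsLocalRing.residue R))

/-- The representation `h ↦ σ (g_ℓ⁻¹ * h * g_ℓ)` of `B'_ℓ`, where `g_ℓ = diag(ϖ ^ ℓ, 1)`. -/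
def twist {ϖ : R} (hϖ : Irreducible ϖ) (ℓ : ℕ)
    (σ : Representation ℂ (Matrix.SpecialLinearGroup (Fin 2) (IsLocalRing.ResidueField R)) V) :
    Representation ℂ (lowerBorel R ℓ) V :=
  (inflation σ).comp (conjDiag hϖ ℓ)

/-- The Mackey component `σ(ℓ)`: the representation of `SL(2, R)` induced from the representation
`h ↦ σ (g_ℓ⁻¹ * h * g_ℓ)` of `B'_ℓ`. -/
def mackeyComponent [TopologicalSpace R] [IsTopologicalRing R] {ϖ : R} (hϖ : Irreducible ϖ)
    (ℓ : ℕ)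
    (σ : Representation ℂ (Matrix.SpecialLinearGroup (Fin 2) (IsLocalRing.ResidueField R)) V) :
    Representation ℂ (Matrix.SpecialLinearGroup (Fin 2) R)
      (smoothIndSpace (lowerBorel R ℓ) (twist hϖ ℓ σ)) :=
  smoothInd (lowerBorel R ℓ) (twist hϖ ℓ σ)

end Mackey

end

end MackeySL2

/-! Over a residue field of two elements, an upper unipotent `u` has `u * u = 1`, so `σ u v + v` is
fixed by the unipotent radical and vanishes: `u` acts by -1. Since `SL(2, 𝔽₂)` is generated by
conjugates of `u`, it acts by scalars, and `σ` is one-dimensional (it is the sign character of S₃).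
Hence `σ(ℓ)` is induced from a character of `B'_ℓ`, and its endomorphisms form a Hecke algebra of
biequivariant functions under convolution. Gelfand's trick applies with the anti-involution `g ↦ (ν
g)⁻¹`, where `ν` is conjugation by `diag(1, -1)`. It fixes the upper unipotents, which represent all
double cosets of `B'_ℓ`, and it preserves the character. So it fixes every biequivariant function
while reversing products, and the algebra is commutative (`smoothInd_endomorphisms_commute`). The
representation is finite-dimensional and factors through a finite quotient. Maschke's theorem and
Schur's lemma then turn commutativity into multiplicity one. -/

namespace MackeySL2

/-! ### Semisimple representations with commutative endomorphism algebra -/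

section Semisimple

open Representation

variable {k G V : Type*} [Field k] [Group G] [AddCommGroup V] [Module k V]

/-- The subrepresentations of a representation that is trivial on `N` are those of the
corresponding representation of `G ⧸ N`. -/
def subrepresentationLiftOrderIso (ρ : Representation k G V) (N : Subgroup G) [N.Normal]
    (h : N ≤ MonoidHom.ker ρ) :
    Subrepresentation ρ ≃o
      Subrepresentation (QuotientGroup.lift N ρ h : Representation k (G ⧸ N) V) where
  toFun W := ⟨W.toSubmodule, fun g v hv => by
    obtain ⟨g, rfl⟩ := QuotientGroup.mk_surjective g
    exact W.apply_mem_toSubmodule g hv⟩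
  invFun W := ⟨W.toSubmodule, fun g _ hv => W.apply_mem_toSubmodule (g : G ⧸ N) hv⟩
  left_inv _ := rfl
  right_inv _ := rfl
  map_rel_iff' := Iff.rfl

/-- Maschke's theorem for the finite group `G ⧸ N`. -/
theorem isSemisimpleRepresentation_of_le_ker [CharZero k] (ρ : Representation k G V)
    (N : Subgroup G) [N.Normal] [N.FiniteIndex] (h : N ≤ MonoidHom.ker ρ) :
    IsSemisimpleRepresentation ρ := by
  have : NeZero (Nat.card (G ⧸ N) : k) := ⟨by exact_mod_cast Nat.card_pos.ne'⟩
  exact (subrepresentationLiftOrderIso ρ N h).complementedLattice_iff.2 inferInstance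

theorem irreducible_toRepresentation_of_isAtom {ρ : Representation k G V}
    {W : Subrepresentation ρ} (hW : IsAtom W) : W.toRepresentation.IsIrreducible := by
  have hbot : ∀ X : Subrepresentation ρ, X = ⊥ ↔ X.toSubmodule = ⊥ := fun X =>
    ⟨fun h => h ▸ rfl, fun h => Subrepresentation.toSubmodule_injective h⟩
  have key : ∀ U : Subrepresentation W.toRepresentation, U = ⊥ ∨ U = ⊤ := by
    intro U
    let X : Subrepresentation ρ := ⟨U.toSubmodule.map W.toSubmodule.subtype, by
      rintro g _ ⟨u, hu, rfl⟩
      exact ⟨_, U.apply_mem_toSubmodule g hu, rfl⟩⟩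
    have hX : X ≤ W := by
      rintro _ ⟨u, -, rfl⟩
      exact u.2
    rcases hW.le_iff.1 hX with h | h
    · left
      apply Subrepresentation.toSubmodule_injective
      refine (Submodule.eq_bot_iff _).2 fun u hu => Subtype.ext ?_
      exact (Submodule.eq_bot_iff _).1 ((hbot X).1 h) u ⟨u, hu, rfl⟩
    · right
      apply Subrepresentation.toSubmodule_injective
      refine Submodule.eq_top_iff'.2 fun u => ?_
      have hu : (u : V) ∈ X := by rw [h]; exact u.2
      obtain ⟨u', hu', he⟩ := hu
      rwa [← Subtype.ext he]
  refine { exists_pair_ne := ⟨⊥, ⊤, fun h => hW.1 ?_⟩, eq_bot_or_eq_top := key }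
  rw [hbot, Submodule.eq_bot_iff]
  intro x hx
  have hmem : (⟨x, hx⟩ : W.toSubmodule) ∈ (⊥ : Subrepresentation W.toRepresentation) := by
    rw [h]; exact Submodule.mem_top
  exact congrArg Subtype.val ((Submodule.mem_bot k).1 hmem)

open scoped MonoidAlgebra in
theorem exists_isInternal_irreducible [FiniteDimensional k V] (ρ : Representation k G V)
    [hρ : IsSemisimpleRepresentation ρ] :
    ∃ (n : ℕ) (W : Fin n → Subrepresentation ρ),
      (∀ i, (W i).toRepresentation.IsIrreducible) ∧
      DirectSum.IsInternal fun i => (W i).toSubmodule := by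
  rw [isSemisimpleRepresentation_iff_isSemisimpleModule_asModule] at hρ
  obtain ⟨s, hs, htop, hsimple⟩ :=
    IsSemisimpleModule.exists_sSupIndep_sSup_simples_eq_top k[G] ρ.asModule
  have : Module.Finite k ρ.asModule := inferInstanceAs (Module.Finite k V)
  have : Module.Finite k[G] ρ.asModule := Module.Finite.of_restrictScalars_finite k k[G] ρ.asModule
  have hfin : s.Finite := WellFoundedGT.finite_of_sSupIndep hs
  have := hfin.to_subtype
  let e := Finite.equivFin s
  let W : Fin (Nat.card s) → Submodule k[G] ρ.asModule := fun i => (e.symm i : s)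
  refine ⟨Nat.card s, fun i => Subrepresentation.ofSubmodule' (W i), fun i => ?_, ?_⟩
  · apply irreducible_toRepresentation_of_isAtom
    exact (OrderIso.isAtom_iff Subrepresentation.subrepresentationSubmoduleOrderIso _).1
      (isSimpleModule_iff_isAtom.1 (hsimple _ (e.symm i).2))
  · have hint : DirectSum.IsInternal W := by
      rw [DirectSum.isInternal_submodule_iff_iSupIndep_and_iSup_eq_top]
      refine ⟨((sSupIndep_iff s).1 hs).comp e.symm.injective, ?_⟩
      rw [← htop, sSup_eq_iSup']
      exact e.symm.iSup_congr fun _ => rfl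
    exact hint

/-- The inclusion of a subrepresentation. -/
def subtypeIntertwining {ρ : Representation k G V} (W : Subrepresentation ρ) :
    IntertwiningMap W.toRepresentation ρ where
  toLinearMap := W.toSubmodule.subtype
  isIntertwining' _ := rfl

theorem exists_comp_eq_id {U : Type*} [AddCommGroup U] [Module k U]
    {ρ : Representation k G V} [hρ : IsSemisimpleRepresentation ρ] {τ : Representation k G U}
    (T : IntertwiningMap τ ρ) (hT : Function.Injective T) :
    ∃ p : IntertwiningMap ρ τ, ∀ u, p (T u) = u := by
  rw [isSemisimpleRepresentation_iff_isSemisimpleModule_asModule] at hρ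
  obtain ⟨p, hp⟩ := IsSemisimpleModule.extension_property
    (IntertwiningMap.equivLinearMapAsModule τ ρ T) hT LinearMap.id
  exact ⟨(IntertwiningMap.equivLinearMapAsModule ρ τ).symm p, fun u => LinearMap.congr_fun hp u⟩

/-- Let `p` be a left inverse of a nonzero, hence injective, `T`. By Schur's lemma `p ∘ S` is a
scalar `c`. Evaluating the commuting endomorphisms `T ∘ p` and `S ∘ p` on the image of `T` gives `S
= c • T`. -/
theorem rank_intertwiningMap_le_one [IsAlgClosed k] [FiniteDimensional k V]
    {ρ : Representation k G V} [IsSemisimpleRepresentation ρ]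
    (hcomm : ∀ S T : IntertwiningMap ρ ρ, S * T = T * S)
    {U : Type*} [AddCommGroup U] [Module k U] (τ : Representation k G U) (hτ : τ.IsIrreducible) :
    Module.rank k (IntertwiningMap τ ρ) ≤ 1 := by
  rw [rank_le_one_iff]
  by_cases h : ∃ T : IntertwiningMap τ ρ, T ≠ 0
  · obtain ⟨T, hT⟩ := h
    have hTi := (IsIrreducible.injective_or_eq_zero T).resolve_right hT
    have : FiniteDimensional k U := FiniteDimensional.of_injective T.toLinearMap hTi
    obtain ⟨p, hp⟩ := exists_comp_eq_id T hTi
    refine ⟨T, fun S => ?_⟩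
    obtain ⟨c, hc⟩ := (IsIrreducible.algebraMap_intertwiningMap_bijective_of_isAlgClosed
      (ρ := τ)).2 (p.comp S)
    refine ⟨c, IntertwiningMap.ext (LinearMap.ext fun u => ?_)⟩
    have h1 := DFunLike.congr_fun (hcomm (T.comp p) (S.comp p)) (T u)
    have h2 := DFunLike.congr_fun hc u
    simp only [IntertwiningMap.mul_apply, IntertwiningMap.comp_apply, hp,
      IntertwiningMap.algebraMap_apply, IntertwiningMap.smul_apply, IntertwiningMap.coe_one,
      id_eq] at h1 h2
    change c • T u = S u
    rw [← h1, ← h2, map_smul]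
  · push Not at h
    exact ⟨0, fun S => ⟨0, by rw [h S, smul_zero]⟩⟩

theorem subtypeIntertwining_ne_zero {ρ : Representation k G V} (W : Subrepresentation ρ)
    (hW : W.toRepresentation.IsIrreducible) : subtypeIntertwining W ≠ 0 := by
  intro h
  refine bot_ne_top (α := Subrepresentation W.toRepresentation)
    (Subrepresentation.toSubmodule_injective (Eq.symm ?_))
  change (⊤ : Submodule k W.toSubmodule) = ⊥
  rw [Submodule.eq_bot_iff]
  exact fun w _ => Subtype.ext (DFunLike.congr_fun h w)

/-- An intertwining map on an internal direct sum is given by its restrictions to the summands. -/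
noncomputable def intertwiningMapEquivPi {ρ : Representation k G V} {n : ℕ}
    {W : Fin n → Subrepresentation ρ} (hint : DirectSum.IsInternal fun i => (W i).toSubmodule)
    {U : Type*} [AddCommGroup U] [Module k U] {τ : Representation k G U} :
    IntertwiningMap ρ τ ≃ₗ[k] ∀ i, IntertwiningMap (W i).toRepresentation τ :=
  LinearEquiv.ofBijective
    { toFun := fun T i => T.comp (subtypeIntertwining (W i))
      map_add' := fun _ _ => rfl
      map_smul' := fun _ _ => rfl } (by
    have hind : ∀ {p : V → Prop}, (∀ i, ∀ w ∈ (W i).toSubmodule, p w) → p 0 →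
        (∀ x y, p x → p y → p (x + y)) → ∀ v, p v := fun {p} h1 h2 h3 v =>
      Submodule.iSup_induction _ (motive := p)
        (by rw [hint.submodule_iSup_eq_top]; exact Submodule.mem_top) h1 h2 h3
    constructor
    · intro S T h
      refine IntertwiningMap.ext (LinearMap.ext (hind ?_ ?_ ?_))
      · intro i w hw
        exact DFunLike.congr_fun (congrFun h i) ⟨w, hw⟩
      · simp
      · intro x y hx hy
        rw [map_add, map_add, hx, hy]
    · intro S
      let e := LinearEquiv.ofBijective (DirectSum.coeLinearMap fun i => (W i).toSubmodule) hint
      let L : V →ₗ[k] U := DirectSum.toModule k (Fin n) U (fun i => (S i).toLinearMap) ∘ₗ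
        e.symm.toLinearMap
      have hL : ∀ i (w : (W i).toSubmodule), L w = S i w := by
        intro i w
        have hw : e.symm (w : V) = DirectSum.lof k (Fin n) (fun i => (W i).toSubmodule) i w := by
          rw [LinearEquiv.symm_apply_eq]
          exact (DirectSum.coeLinearMap_lof (fun i => (W i).toSubmodule) i w).symm
        change DirectSum.toModule k (Fin n) U (fun i => (S i).toLinearMap) (e.symm (w : V)) = _
        rw [hw, DirectSum.toModule_lof]
        rfl
      refine ⟨L.intertwiningMap_of_isIntertwiningMap ρ τ fun g => hind ?_ ?_ ?_, ?_⟩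
      · intro i w hw
        rw [hL i ⟨w, hw⟩, ← (S i).isIntertwining, ← hL]
        rfl
      · simp
      · intro x y hx hy
        simp only [map_add, hx, hy]
      · funext i
        exact IntertwiningMap.ext (LinearMap.ext fun w => hL i w))

/-- Each irreducible summand has a one-dimensional space of maps into `ρ`, so `dim End` counts the
summands. An isomorphism between two summands would give two proportional embeddings with
independent images. -/
theorem isSumOfDistinctIrreducibles_of_commute {V : Type*} [AddCommGroup V] [Module ℂ V]
    [FiniteDimensional ℂ V] (ρ : Representation ℂ G V) [IsSemisimpleRepresentation ρ]
    (hcomm : ∀ S T : IntertwiningMap ρ ρ, S * T = T * S) :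
    IsSumOfDistinctIrreducibles ρ (selfIntertwiningNumber ρ) := by
  obtain ⟨n, W, hirr, hint⟩ := exists_isInternal_irreducible ρ
  have hone : ∀ i, Module.finrank ℂ (IntertwiningMap (W i).toRepresentation ρ) = 1 := by
    intro i
    have hne := subtypeIntertwining_ne_zero (W i) (hirr i)
    have h1 := rank_intertwiningMap_le_one hcomm _ (hirr i)
    have : Nontrivial (IntertwiningMap (W i).toRepresentation ρ) := ⟨_, 0, hne⟩
    refine le_antisymm (Module.finrank_le_of_rank_le (by simpa using h1)) Module.finrank_pos
  have hn : selfIntertwiningNumber ρ = n := by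
    rw [selfIntertwiningNumber, (intertwiningMapEquivPi hint).finrank_eq,
      Module.finrank_pi_fintype]
    simp [hone]
  rw [hn]
  refine ⟨W, hirr, fun i j hij => ⟨fun e => ?_⟩, hint⟩
  have hne := subtypeIntertwining_ne_zero (W i) (hirr i)
  obtain ⟨c, hc⟩ := (finrank_eq_one_iff_of_nonzero' _ hne).1 (hone i)
    ((subtypeIntertwining (W j)).comp e.toIntertwiningMap)
  have := (hirr i).toNontrivial
  have hdis : Disjoint (W i).toSubmodule (W j).toSubmodule :=
    hint.submodule_iSupIndep.pairwiseDisjoint hij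
  apply hne
  ext w
  have hw : (c • (w : V)) = (e w : V) := DFunLike.congr_fun hc w
  have h0 : (e w : V) = 0 := by
    refine Submodule.disjoint_def.1 hdis _ ?_ (e w).2
    rw [← hw]
    exact Submodule.smul_mem _ _ w.2
  have h1 : w = 0 := by
    rw [← e.symm_apply_apply w, (Subtype.ext h0 : e w = 0), map_zero]
  rw [h1]
  rfl

end Semisimple

/-! ### Convolution on a coset space and Gelfand's trick -/

section Convolution

variable {G : Type*} [Group G]

/-- Change of variables: `e` permutes the left cosets, and the choice of representatives is
immaterial for a right `H`-invariant function. -/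
theorem sum_out_eq_sum_out {H : Subgroup G} [Fintype (G ⧸ H)] {M : Type*} [AddCommMonoid M]
    {F : G → M} (hF : ∀ g, ∀ h ∈ H, F (g * h) = F g) (e : G ≃ G)
    (he : ∀ a b, a⁻¹ * b ∈ H ↔ (e a)⁻¹ * e b ∈ H) :
    ∑ z : G ⧸ H, F (e z.out) = ∑ z : G ⧸ H, F z.out := by
  have hF' : ∀ a b, a⁻¹ * b ∈ H → F a = F b := fun a b hab => by
    rw [← hF a _ hab, mul_inv_cancel_left]
  let E : G ⧸ H ≃ G ⧸ H := Quotient.congr e fun a b => by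
    change QuotientGroup.leftRel H a b ↔ QuotientGroup.leftRel H (e a) (e b)
    rw [QuotientGroup.leftRel_apply, QuotientGroup.leftRel_apply, he]
  refine Fintype.sum_equiv E _ _ fun z => hF' _ _ ?_
  rw [← QuotientGroup.leftRel_apply]
  apply Quotient.exact
  rw [Quotient.out_eq]
  conv_rhs => rw [← Quotient.out_eq z]
  rfl

/-- The convolution of two `χ`-biequivariant functions, written as a sum over `G ⧸ H`. -/
noncomputable def convolution (H : Subgroup G) [Fintype (G ⧸ H)] (b a : G → ℂ) (y : G) : ℂ :=
  ∑ z : G ⧸ H, a z.out⁻¹ * b (y * z.out)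

/-- **Gelfand's trick**. -/
theorem convolution_comm {H : Subgroup G} [Fintype (G ⧸ H)] {χ : H → ℂ}
    (hχ : ∀ h, χ h⁻¹ * χ h = 1) {a b : G → ℂ}
    (hal : ∀ (h : H) g, a (h * g) = χ h * a g) (har : ∀ (h : H) g, a (g * h) = χ h * a g)
    (hbl : ∀ (h : H) g, b (h * g) = χ h * b g) (hbr : ∀ (h : H) g, b (g * h) = χ h * b g)
    (ν : G ≃* G) (hν : ∀ g, ν g ∈ H ↔ g ∈ H)
    (ha : ∀ g, a (ν g)⁻¹ = a g) (hb : ∀ g, b (ν g)⁻¹ = b g)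
    (hab : ∀ g, convolution H a b (ν g)⁻¹ = convolution H a b g) :
    convolution H b a = convolution H a b := by
  funext y
  rw [← hab y]
  have ha' : ∀ g, a (ν g) = a g⁻¹ := fun g => by rw [← ha g⁻¹, map_inv, inv_inv]
  -- Substitute `z ↦ ν z` and use the invariance of `a` and `b`; the later substitution `z ↦ y * z`
  -- yields the convolution in the other order.
  have h1 : convolution H a b (ν y)⁻¹ = ∑ z : G ⧸ H, b z.out * a (z.out⁻¹ * y) := by
    rw [convolution, ← sum_out_eq_sum_out (F := fun z => b z⁻¹ * a ((ν y)⁻¹ * z)) _ ν.toEquiv]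
    · refine Finset.sum_congr rfl fun z _ => ?_
      change b (ν z.out)⁻¹ * a ((ν y)⁻¹ * ν z.out) = _
      rw [hb, ← map_inv, ← map_mul, ha', mul_inv_rev, inv_inv]
    · intro p q
      change _ ↔ (ν p)⁻¹ * ν q ∈ H
      rw [← map_inv, ← map_mul, hν]
    · intro g h hh
      have h1 := hbl (⟨h, hh⟩ : H)⁻¹ g⁻¹
      have h2 := har ⟨h, hh⟩ ((ν y)⁻¹ * g)
      simp only [InvMemClass.coe_inv] at h1 h2
      rw [mul_inv_rev, h1, ← mul_assoc, h2, mul_mul_mul_comm, hχ, one_mul]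
  rw [h1, convolution, ← sum_out_eq_sum_out (F := fun z => b z * a (z⁻¹ * y)) _ (Equiv.mulLeft y)]
  · refine Finset.sum_congr rfl fun z _ => ?_
    simp [mul_comm]
  · intro p q
    simp [mul_assoc]
  · intro g h hh
    have h1 := hal (⟨h, hh⟩ : H)⁻¹ (g⁻¹ * y)
    have h2 := hbr ⟨h, hh⟩ g
    simp only [InvMemClass.coe_inv] at h1 h2
    rw [mul_inv_rev, mul_assoc, h1, h2, mul_mul_mul_comm, mul_comm (χ _), hχ, one_mul]

end Convolution

/-! ### Smooth induction and the Hecke algebra of a character -/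

section Induced

open Representation

variable {G : Type*} [Group G] [TopologicalSpace G]
variable {V : Type*} [AddCommGroup V] [Module ℂ V] {H : Subgroup G} {τ : Representation ℂ H V}

theorem finiteDimensional_smoothIndSpace [H.FiniteIndex] [FiniteDimensional ℂ V] :
    FiniteDimensional ℂ (smoothIndSpace H τ) := by
  let L : smoothIndSpace H τ →ₗ[ℂ] (G ⧸ H → V) :=
    { toFun := fun f z => f.1 z.out⁻¹
      map_add' := fun _ _ => rfl
      map_smul' := fun _ _ => rfl }
  have : Fintype (G ⧸ H) := Fintype.ofFinite _
  refine FiniteDimensional.of_injective L ((injective_iff_map_eq_zero L).2 fun f hf => ?_)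
  refine Subtype.ext (funext fun g => ?_)
  obtain ⟨h, hh⟩ := QuotientGroup.mk_out_eq_mul H g⁻¹
  have h1 : f.1 ((g⁻¹ : G) : G ⧸ H).out⁻¹ = 0 := congrFun hf _
  rw [hh, mul_inv_rev, inv_inv, ← Subgroup.coe_inv, f.2.1] at h1
  have := congrArg (τ h) h1
  rwa [map_zero, ← Module.End.mul_apply, ← map_mul, mul_inv_cancel, map_one] at this

/-- Equivariance makes `f` constant on the open cosets `K x`. -/
theorem isLocallyConstant_of_equivariant [ContinuousMul G] (K : Subgroup G)
    (hK : IsOpen (K : Set G))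
    (hKH : K ≤ H) (hτ : ∀ k : H, (k : G) ∈ K → τ k = 1) {f : G → V}
    (hf : ∀ (h : H) (g : G), f (h * g) = τ h (f g)) : IsLocallyConstant f := by
  rw [IsLocallyConstant.iff_exists_open]
  intro x
  refine ⟨(fun y => y * x⁻¹) ⁻¹' K, hK.preimage (continuous_mul_const _), by simp, ?_⟩
  intro y hy
  have := hf ⟨y * x⁻¹, hKH hy⟩ x
  rw [hτ ⟨y * x⁻¹, hKH hy⟩ hy] at this
  simpa using this

theorem normalCore_le_ker_smoothInd [ContinuousMul G] {K : Subgroup G} (hKH : K ≤ H)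
    (hτ : ∀ k : H, (k : G) ∈ K → τ k = 1) : K.normalCore ≤ MonoidHom.ker (smoothInd H τ) := by
  intro g hg
  refine LinearMap.ext fun f => Subtype.ext (funext fun x => ?_)
  have hx : x * g * x⁻¹ ∈ K := K.normalCore_le (K.normalCore_normal.conj_mem g hg x)
  have := f.2.1 ⟨_, hKH hx⟩ x
  rw [hτ ⟨_, hKH hx⟩ hx] at this
  change f.1 (x * g) = f.1 x
  simpa using this

theorem isSemisimpleRepresentation_smoothInd [ContinuousMul G] {K : Subgroup G}
    [K.FiniteIndex] (hKH : K ≤ H)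
    (hτ : ∀ k : H, (k : G) ∈ K → τ k = 1) : IsSemisimpleRepresentation (smoothInd H τ) :=
  isSemisimpleRepresentation_of_le_ker _ _ (normalCore_le_ker_smoothInd hKH hτ)

open scoped Classical in
/-- The function supported on `H` with `h ↦ τ h v`. -/
noncomputable def delta (hlc : ∀ f : G → V, (∀ (h : H) (g : G), f (h * g) = τ h (f g)) →
    IsLocallyConstant f) (v : V) : smoothIndSpace H τ :=
  have h : ∀ (h : H) (g : G), (if hg : (h * g : G) ∈ H then τ ⟨_, hg⟩ v else 0) =
      τ h (if hg : g ∈ H then τ ⟨g, hg⟩ v else 0) := by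
    intro h g
    by_cases hg : g ∈ H
    · rw [dif_pos hg, dif_pos (H.mul_mem h.2 hg), ← Module.End.mul_apply, ← map_mul]
      rfl
    · rw [dif_neg hg, dif_neg (mt (H.mul_mem_cancel_left h.2).1 hg), map_zero]
  ⟨fun g => if hg : g ∈ H then τ ⟨g, hg⟩ v else 0, h, hlc _ h⟩

/-- The function `δ` supported on `H` generates the induced representation, so `T` is determined by
`T δ`. This function is biequivariant, and composition of endomorphisms becomes convolution. -/
theorem smoothInd_endomorphisms_commute [ContinuousMul G] [H.FiniteIndex]
    (hV : Module.finrank ℂ V = 1)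
    (hlc : ∀ f : G → V, (∀ (h : H) (g : G), f (h * g) = τ h (f g)) → IsLocallyConstant f)
    (ν : G ≃* G) (hν : ∀ g, ν g ∈ H ↔ g ∈ H)
    (hτν : ∀ h : H, τ ⟨ν h, (hν h).2 h.2⟩ = τ h⁻¹)
    (hdc : ∀ g, ∃ (h₁ h₂ : H) (s : G), ν s = s⁻¹ ∧ g = h₁ * s * h₂)
    (S T : IntertwiningMap (smoothInd H τ) (smoothInd H τ)) : S * T = T * S := by
  have : Fintype (G ⧸ H) := Fintype.ofFinite _
  have : FiniteDimensional ℂ V := FiniteDimensional.of_finrank_eq_succ hV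
  obtain ⟨e⟩ : Nonempty (V ≃ₗ[ℂ] ℂ) :=
    FiniteDimensional.nonempty_linearEquiv_of_finrank_eq (by simp [hV])
  let χ : H → ℂ := fun h => e (τ h (e.symm 1))
  have hχτ : ∀ h v, τ h v = χ h • v := by
    intro h v
    apply e.injective
    have hv : v = e v • e.symm 1 := e.injective (by simp)
    conv_lhs => rw [hv]
    simp [χ, mul_comm]
  have hχmul : ∀ h h', χ (h * h') = χ h * χ h' := by
    intro h h'
    have := hχτ h (τ h' (e.symm 1))
    simp only [χ]
    rw [map_mul, Module.End.mul_apply, this, map_smul, smul_eq_mul]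
  have hχ : ∀ h, χ h⁻¹ * χ h = 1 := by
    intro h
    rw [← hχmul, inv_mul_cancel]
    simp [χ]
  let δ : smoothIndSpace H τ := delta hlc (e.symm 1)
  have hδ : ∀ h : H, e (δ.1 h) = χ h := by
    intro h
    exact congrArg e (dif_pos h.2)
  have hδ0 : ∀ g ∉ H, δ.1 g = 0 := fun g hg => dif_neg hg
  have hδH : ∀ h : H, smoothInd H τ h δ = χ h • δ := by
    intro h
    refine Subtype.ext (funext fun g => e.injective ?_)
    change e (δ.1 (g * h)) = e (χ h • δ.1 g)
    by_cases hg : g ∈ H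
    · have h1 := hδ (⟨g, hg⟩ * h)
      have h2 := hδ ⟨g, hg⟩
      simp only [Subgroup.coe_mul] at h1 h2
      rw [h1, map_smul, h2, hχmul, smul_eq_mul, mul_comm]
    · rw [hδ0 _ hg, hδ0 _ (mt (H.mul_mem_cancel_right h.2).1 hg), smul_zero]
  -- The translates of `δ` have disjoint supports `H * z.out⁻¹`, which cover `G`.
  have hdecomp : ∀ f : smoothIndSpace H τ,
      f = ∑ z : G ⧸ H, e (f.1 z.out⁻¹) • smoothInd H τ z.out δ := by
    intro f
    refine Subtype.ext (funext fun y => e.injective ?_)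
    have h1 : (∑ z : G ⧸ H, e (f.1 z.out⁻¹) • smoothInd H τ z.out δ).1 y =
        ∑ z : G ⧸ H, e (f.1 z.out⁻¹) • δ.1 (y * z.out) := by
      rw [Submodule.coe_sum, Finset.sum_apply]
      rfl
    obtain ⟨h, hh⟩ := QuotientGroup.mk_out_eq_mul H y⁻¹
    rw [h1, Finset.sum_eq_single ((y⁻¹ : G) : G ⧸ H)]
    · rw [hh, mul_inv_cancel_left, mul_inv_rev, inv_inv, ← Subgroup.coe_inv, f.2.1, hχτ, map_smul,
        map_smul, hδ, smul_eq_mul, smul_eq_mul, mul_right_comm, hχ, one_mul]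
    · intro z _ hz
      rw [hδ0, smul_zero]
      intro hy
      apply hz
      rw [← QuotientGroup.out_eq' z, eq_comm, QuotientGroup.eq, inv_inv]
      exact hy
    · exact fun h => absurd (Finset.mem_univ _) h
  let φ : IntertwiningMap (smoothInd H τ) (smoothInd H τ) → G → ℂ := fun T g => e ((T δ).1 g)
  have hφl : ∀ T (h : H) g, φ T (h * g) = χ h * φ T g := by
    intro T h g
    simp only [φ]
    rw [(T δ).2.1, hχτ, map_smul, smul_eq_mul]
  have hφr : ∀ T (h : H) g, φ T (g * h) = χ h * φ T g := by
    intro T h g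
    have := IntertwiningMap.isIntertwining _ _ T h δ
    rw [hδH, map_smul] at this
    have h2 := congrFun (congrArg Subtype.val this) g
    have h3 : (T δ).1 (g * h) = χ h • (T δ).1 g := h2.symm
    simp only [φ]
    rw [h3, map_smul, smul_eq_mul]
  have hχν : ∀ h : H, χ ⟨ν h, (hν h).2 h.2⟩⁻¹ = χ h := by
    intro h
    have h1 := hχ ⟨ν h, (hν h).2 h.2⟩
    have h2 : χ ⟨ν h, (hν h).2 h.2⟩ = χ h⁻¹ := by simp only [χ]; rw [hτν]
    have h3 := hχ h
    rw [h2] at h1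
    exact mul_right_cancel₀ (right_ne_zero_of_mul_eq_one h1) (by rw [h1, mul_comm, h3])
  -- The anti-involution fixes `s` and swaps the two outer factors, whose character values it
  -- preserves.
  have hφν : ∀ T g, φ T (ν g)⁻¹ = φ T g := by
    intro T g
    obtain ⟨h₁, h₂, s, hs, rfl⟩ := hdc g
    have : (ν (h₁ * s * h₂))⁻¹ = ((⟨ν h₂, (hν h₂).2 h₂.2⟩⁻¹ : H) : G) * s *
        ((⟨ν h₁, (hν h₁).2 h₁.2⟩⁻¹ : H) : G) := by
      simp [hs, mul_assoc]
    rw [this, hφr, hφl, hφr, hφl, hχν, hχν]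
    ring
  have happly : ∀ (T : IntertwiningMap (smoothInd H τ) (smoothInd H τ)) f y,
      e ((T f).1 y) = convolution H (φ T) (fun g => e (f.1 g)) y := by
    intro T f y
    conv_lhs => rw [hdecomp f]
    rw [map_sum, Submodule.coe_sum, Finset.sum_apply, map_sum]
    refine Finset.sum_congr rfl fun z _ => ?_
    rw [map_smul, T.isIntertwining]
    exact map_smul e _ _
  have hmul : ∀ S T, φ (S * T) = convolution H (φ S) (φ T) := fun S T =>
    funext fun y => happly S (T δ) y
  have hcomm : φ (S * T) = φ (T * S) := by
    rw [hmul, hmul]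
    -- The convolution is again the function of an endomorphism, so `hφν` supplies its invariance
    -- too.
    refine convolution_comm hχ (hφl T) (hφr T) (hφl S) (hφr S) ν hν (hφν T) (hφν S) fun g => ?_
    rw [← hmul, hφν]
  refine IntertwiningMap.ext (LinearMap.ext fun f => Subtype.ext (funext fun y => e.injective ?_))
  exact (happly (S * T) f y).trans (hcomm ▸ (happly (T * S) f y).symm)

end Induced

/-! ### Factorization in `SL(2)` over a local ring -/

section LocalRing

open Matrix SpecialLinearGroup

/-- The matrix `!![a, b; c, d]` as an element of `SL(2, R)`. -/
def slOf {R : Type*} [CommRing R] (a b c d : R) (h : a * d - b * c = 1) :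
    SpecialLinearGroup (Fin 2) R :=
  ⟨!![a, b; c, d], by rwa [Matrix.det_fin_two_of]⟩

@[simp]
theorem coe_slOf {R : Type*} [CommRing R] (a b c d : R) (h : a * d - b * c = 1) :
    (slOf a b c d h : Matrix (Fin 2) (Fin 2) R) = !![a, b; c, d] := rfl

/-- The matrix `!![1, x; 0, 1]` as an element of `SL(2, R)`. -/
def upperUnipotent {R : Type*} [CommRing R] (x : R) : SpecialLinearGroup (Fin 2) R :=
  slOf 1 x 0 1 (by simp)

@[simp]
theorem coe_upperUnipotent {R : Type*} [CommRing R] (x : R) :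
    (upperUnipotent x : Matrix (Fin 2) (Fin 2) R) = !![1, x; 0, 1] := rfl

theorem upperUnipotent_zero {R : Type*} [CommRing R] : upperUnipotent (0 : R) = 1 := by
  ext i j
  fin_cases i <;> fin_cases j <;> simp

/-- If the upper left entry is a unit, elimination needs no right factor. Otherwise the determinant
forces the upper right entry to be a unit, and a column operation restores the first case. -/
theorem exists_eq_lower_mul_upper_mul_lower {R : Type*} [CommRing R] [IsLocalRing R]
    (g : SpecialLinearGroup (Fin 2) R) :
    ∃ (h₁ h₂ : SpecialLinearGroup (Fin 2) R) (x : R), h₁ 0 1 = 0 ∧ h₂ 0 1 = 0 ∧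
      g = h₁ * upperUnipotent x * h₂ := by
  have key : ∀ g : SpecialLinearGroup (Fin 2) R, IsUnit (g 0 0) →
      ∃ (h₁ : SpecialLinearGroup (Fin 2) R) (x : R), h₁ 0 1 = 0 ∧
        g = h₁ * upperUnipotent x := by
    intro g hg
    obtain ⟨a', ha'⟩ := hg.exists_right_inv
    have hdet := g.det_coe
    rw [Matrix.det_fin_two] at hdet
    refine ⟨slOf (g 0 0) 0 (g 1 0) a' (by simp [ha']), a' * g 0 1, rfl, ?_⟩
    ext i j
    fin_cases i <;> fin_cases j
    · simp [Matrix.mul_apply, Fin.sum_univ_two]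
    · simp [Matrix.mul_apply, Fin.sum_univ_two]
      linear_combination (-g 0 1) * ha'
    · simp [Matrix.mul_apply, Fin.sum_univ_two]
    · simp [Matrix.mul_apply, Fin.sum_univ_two]
      linear_combination (-g 1 1) * ha' + a' * hdet
  by_cases hg : IsUnit (g 0 0)
  · obtain ⟨h₁, x, hh, he⟩ := key g hg
    exact ⟨h₁, 1, x, hh, by simp, by rw [mul_one, ← he]⟩
  · have hdet := g.det_coe
    rw [Matrix.det_fin_two] at hdet
    have hb : IsUnit (g 0 1) := by
      have h1 : IsUnit (g 0 0 * g 1 1 + -(g 0 1 * g 1 0)) := by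
        rw [← sub_eq_add_neg, hdet]; exact isUnit_one
      rcases IsLocalRing.isUnit_or_isUnit_of_isUnit_add h1 with h | h
      · exact absurd (isUnit_of_mul_isUnit_left h) hg
      · exact isUnit_of_mul_isUnit_left ((IsUnit.neg_iff _).1 h)
    obtain ⟨b', hb'⟩ := hb.exists_right_inv
    -- The lower left entry is chosen to make the upper left entry of `g * L` equal to 1.
    let L : SpecialLinearGroup (Fin 2) R :=
      slOf 1 0 (b' * (1 - g 0 0)) 1 (by simp)
    have h1 : (g * L) 0 0 = 1 := by
      simp [L, Matrix.mul_apply, Fin.sum_univ_two]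
      linear_combination (1 - g 0 0) * hb'
    obtain ⟨h₁, x, hh, he⟩ := key (g * L) (by rw [h1]; exact isUnit_one)
    refine ⟨h₁, L⁻¹, x, hh, ?_, by rw [← he, mul_inv_cancel_right]⟩
    simp [L, Matrix.adjugate_fin_two]

end LocalRing

/-! ### Cuspidal representations over the field of two elements -/

section Cuspidal

open Matrix

theorem eq_one_of_ne_zero_of_card_eq_two {k : Type*} [Field k] (hk : Nat.card k = 2) {x : k}
    (hx : x ≠ 0) : x = 1 :=
  ((Nat.card_eq_two_iff' (0 : k)).1 hk).unique hx one_ne_zero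

variable {k : Type*} [Field k] {V : Type*} [AddCommGroup V] [Module ℂ V]
  {σ : Representation ℂ (SpecialLinearGroup (Fin 2) k) V}

/-- The unipotent radical has order two, so `σ u v + v` is a sum over it and is fixed by it;
cuspidality makes this sum zero. -/
theorem IsCuspidal.apply_upper (hσ : IsCuspidal σ) (hk : Nat.card k = 2) (v : V) :
    σ (upperUnipotent 1) v = -v := by
  set u : SpecialLinearGroup (Fin 2) k := upperUnipotent 1 with hu1
  have h2 : (1 : k) + 1 = 0 := by
    by_contra h
    simpa using eq_one_of_ne_zero_of_card_eq_two hk h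
  have hu : u * u = 1 := by
    ext i j
    fin_cases i <;> fin_cases j <;> simp [hu1, Matrix.mul_apply, Fin.sum_univ_two, h2]
  have h0 : σ u v + v = 0 := by
    refine hσ.2 _ fun x => ?_
    change σ (upperUnipotent x) _ = _
    by_cases hx : x = 0
    · rw [hx, upperUnipotent_zero, map_one, Module.End.one_apply]
    · have : upperUnipotent x = u := by
        rw [hu1, eq_one_of_ne_zero_of_card_eq_two hk hx]
      rw [this, map_add, ← Module.End.mul_apply, ← map_mul, hu, map_one, Module.End.one_apply,
        add_comm]
  exact eq_neg_of_add_eq_zero_left h0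

theorem IsCuspidal.exists_smul (hσ : IsCuspidal σ) (hk : Nat.card k = 2)
    (g : SpecialLinearGroup (Fin 2) k) : ∃ c : ℂ, ∀ v, σ g v = c • v := by
  have hmul : ∀ g g', (∃ c : ℂ, ∀ v, σ g v = c • v) → (∃ c : ℂ, ∀ v, σ g' v = c • v) →
      ∃ c : ℂ, ∀ v, σ (g * g') v = c • v := by
    rintro g g' ⟨c, hc⟩ ⟨c', hc'⟩
    exact ⟨c * c', fun v => by rw [map_mul, Module.End.mul_apply, hc', hc, mul_smul]⟩
  have hone : ∃ c : ℂ, ∀ v, σ 1 v = c • v := ⟨1, by simp⟩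
  have hupper : ∀ x : k, ∃ c : ℂ, ∀ v, σ (upperUnipotent x) v = c • v := by
    intro x
    by_cases hx : x = 0
    · rwa [hx, upperUnipotent_zero]
    · obtain rfl := eq_one_of_ne_zero_of_card_eq_two hk hx
      exact ⟨-1, fun v => by rw [hσ.apply_upper hk, neg_one_smul]⟩
  have hlower : ∀ h : SpecialLinearGroup (Fin 2) k, h 0 1 = 0 →
      ∃ c : ℂ, ∀ v, σ h v = c • v := by
    intro h hh
    have hdet := h.det_coe
    rw [Matrix.det_fin_two, hh, zero_mul, sub_zero] at hdet
    have h00 := eq_one_of_ne_zero_of_card_eq_two hk (left_ne_zero_of_mul_eq_one hdet)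
    have h11 := eq_one_of_ne_zero_of_card_eq_two hk (right_ne_zero_of_mul_eq_one hdet)
    -- The Weyl element carries lower unipotents to upper ones, and conjugation does not change a
    -- scalar.
    let w : SpecialLinearGroup (Fin 2) k := slOf 0 1 (-1) 0 (by simp)
    have he : h = w * upperUnipotent (-h 1 0) * w⁻¹ := by
      rw [eq_mul_inv_iff_mul_eq]
      ext i j
      fin_cases i <;> fin_cases j <;>
        simp [w, Matrix.mul_apply, Fin.sum_univ_two, h00, h11, hh]
    obtain ⟨c, hc⟩ := hupper (-h 1 0)
    refine ⟨c, fun v => ?_⟩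
    rw [he, map_mul, map_mul, Module.End.mul_apply, Module.End.mul_apply, hc, map_smul,
      ← Module.End.mul_apply, ← map_mul, mul_inv_cancel, map_one, Module.End.one_apply]
  obtain ⟨h₁, h₂, x, hh₁, hh₂, rfl⟩ := exists_eq_lower_mul_upper_mul_lower g
  exact hmul _ _ (hmul _ _ (hlower _ hh₁) (hupper x)) (hlower _ hh₂)

/-- A cuspidal representation of `SL(2, 𝔽₂)` is one-dimensional. -/
theorem IsCuspidal.finrank_eq_one (hσ : IsCuspidal σ) (hk : Nat.card k = 2) :
    Module.finrank ℂ V = 1 := by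
  have := hσ.1
  -- Scalars preserve every subspace, so irreducibility leaves only the trivial ones.
  have hall : ∀ W : Submodule ℂ V, W = ⊥ ∨ W = ⊤ := by
    intro W
    let X : Subrepresentation σ := ⟨W, fun g v hv => by
      obtain ⟨c, hc⟩ := hσ.exists_smul hk g
      rw [hc]
      exact W.smul_mem c hv⟩
    exact (eq_bot_or_eq_top X).imp (congrArg Subrepresentation.toSubmodule)
      (congrArg Subrepresentation.toSubmodule)
  have hnt : Nontrivial V := by
    by_contra h
    rw [not_nontrivial_iff_subsingleton] at h
    exact bot_ne_top (α := Subrepresentation σ)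
      (Subrepresentation.toSubmodule_injective (Subsingleton.elim _ _))
  obtain ⟨v, hv⟩ := exists_ne (0 : V)
  refine _root_.finrank_eq_one v hv fun w => ?_
  have h := (hall (Submodule.span ℂ {v})).resolve_left (by simpa using hv)
  exact Submodule.mem_span_singleton.1 (h ▸ Submodule.mem_top)

end Cuspidal

/-! ### The subgroups `B'_ℓ` and the anti-involution on them -/

section LowerBorel

open Matrix IsLocalRing

/-- Conjugation by `diag(1, -1)`. -/
def conjSign (R : Type*) [CommRing R] :
    SpecialLinearGroup (Fin 2) R ≃* SpecialLinearGroup (Fin 2) R where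
  toFun g := slOf (g 0 0) (-g 0 1) (-g 1 0) (g 1 1) (by
    rw [neg_mul_neg, ← det_fin_two, g.det_coe])
  invFun g := slOf (g 0 0) (-g 0 1) (-g 1 0) (g 1 1) (by
    rw [neg_mul_neg, ← det_fin_two, g.det_coe])
  left_inv g := by
    ext i j
    fin_cases i <;> fin_cases j <;> simp
  right_inv g := by
    ext i j
    fin_cases i <;> fin_cases j <;> simp
  map_mul' g h := by
    ext i j
    fin_cases i <;> fin_cases j <;> simp [Matrix.mul_apply, Fin.sum_univ_two, add_comm]

theorem coe_conjSign {R : Type*} [CommRing R] (g : SpecialLinearGroup (Fin 2) R) :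
    (conjSign R g : Matrix (Fin 2) (Fin 2) R) = !![g 0 0, -g 0 1; -g 1 0, g 1 1] := rfl

theorem mem_lowerBorel {R : Type*} [CommRing R] [IsLocalRing R] {ℓ : ℕ}
    {g : SpecialLinearGroup (Fin 2) R} : g ∈ lowerBorel R ℓ ↔ g 0 1 ∈ maximalIdeal R ^ ℓ := Iff.rfl

theorem conjSign_mem_lowerBorel {R : Type*} [CommRing R] [IsLocalRing R] {ℓ : ℕ}
    (g : SpecialLinearGroup (Fin 2) R) : conjSign R g ∈ lowerBorel R ℓ ↔ g ∈ lowerBorel R ℓ :=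
  neg_mem_iff (x := g 0 1) (H := maximalIdeal R ^ ℓ)

theorem lowerBorel_anti (R : Type*) [CommRing R] [IsLocalRing R] {m n : ℕ} (h : m ≤ n) :
    lowerBorel R n ≤ lowerBorel R m := fun _ hg => Ideal.pow_le_pow_right h hg

/-- The subgroup contains the kernel of reduction modulo the `n`-th power of the maximal ideal, and
the reduced group is finite. -/
theorem finiteIndex_lowerBorel (R : Type*) [CommRing R] [IsLocalRing R] [IsNoetherianRing R]
    [Finite (ResidueField R)] (n : ℕ) : (lowerBorel R n).FiniteIndex := by
  have : Finite (R ⧸ maximalIdeal R) := inferInstanceAs (Finite (ResidueField R))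
  have : Finite (R ⧸ maximalIdeal R ^ n) :=
    Ideal.finite_quotient_pow (IsNoetherian.noetherian _) n
  have : Finite (SpecialLinearGroup (Fin 2) (R ⧸ maximalIdeal R ^ n)) := inferInstance
  refine Subgroup.finiteIndex_of_le
    (H := (SpecialLinearGroup.map (n := Fin 2) (Ideal.Quotient.mk (maximalIdeal R ^ n))).ker)
    fun g hg => ?_
  have h := congrArg (fun m : SpecialLinearGroup (Fin 2) (R ⧸ maximalIdeal R ^ n) => m 0 1)
    (MonoidHom.mem_ker.1 hg)
  rw [mem_lowerBorel, ← Ideal.Quotient.eq_zero_iff_mem]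
  simpa using h

theorem isOpen_lowerBorel (R : Type*) [CommRing R] [IsLocalRing R] [IsNoetherianRing R]
    [TopologicalSpace R] [IsTopologicalRing R] [CompactSpace R] [T2Space R] (n : ℕ) :
    IsOpen (lowerBorel R n : Set (SpecialLinearGroup (Fin 2) R)) :=
  (isOpen_maximalIdeal_pow R n).preimage (f := fun g : SpecialLinearGroup (Fin 2) R => g 0 1)
    ((continuous_apply (1 : Fin 2)).comp (SpecialLinearGroup.continuous_apply _ continuous_id 0))

theorem residue_diag_eq_one {R : Type*} [CommRing R] [IsLocalRing R]
    (hR : Nat.card (ResidueField R) = 2) {ℓ : ℕ} (hℓ : 1 ≤ ℓ) {g : SpecialLinearGroup (Fin 2) R}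
    (hg : g ∈ lowerBorel R ℓ) : residue R (g 0 0) = 1 ∧ residue R (g 1 1) = 1 := by
  have h1 : residue R (g 0 1) = 0 := by
    have h := lowerBorel_anti R hℓ hg
    rwa [mem_lowerBorel, pow_one, ← residue_eq_zero_iff] at h
  have hdet := congrArg (residue R) g.det_coe
  rw [det_fin_two, map_sub, map_mul, map_mul, h1, zero_mul, sub_zero, map_one] at hdet
  exact ⟨eq_one_of_ne_zero_of_card_eq_two hR (left_ne_zero_of_mul_eq_one hdet),
    eq_one_of_ne_zero_of_card_eq_two hR (right_ne_zero_of_mul_eq_one hdet)⟩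

variable {R : Type*} [CommRing R] [IsDomain R] [IsDiscreteValuationRing R]
  {V : Type*} [AddCommGroup V] [Module ℂ V]

theorem twist_apply {ϖ : R} (hϖ : Irreducible ϖ) (ℓ : ℕ)
    (σ : Representation ℂ (SpecialLinearGroup (Fin 2) (ResidueField R)) V) (h : lowerBorel R ℓ) :
    twist hϖ ℓ σ h = σ (SpecialLinearGroup.map (residue R) (conjDiag hϖ ℓ h)) := rfl

/-- Conjugation removes only `ϖ ^ ℓ` from the upper right entry, so the extra power still kills it
in the residue field. The lower left entry dies because `1 ≤ ℓ`, and the diagonal reduces to 1. -/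
theorem twist_eq_one {ϖ : R} (hϖ : Irreducible ϖ) {ℓ : ℕ} (hℓ : 1 ≤ ℓ)
    (hR : Nat.card (ResidueField R) = 2)
    (σ : Representation ℂ (SpecialLinearGroup (Fin 2) (ResidueField R)) V) (h : lowerBorel R ℓ)
    (hh : h.1 ∈ lowerBorel R (ℓ + 1)) : twist hϖ ℓ σ h = 1 := by
  have hϖ0 : residue R ϖ = 0 := (residue_eq_zero_iff _).2 hϖ.not_isUnit
  obtain ⟨b, hb⟩ := exists_eq_pow_mul hϖ ⟨h.1, hh⟩
  have hu : upperQuot hϖ h = ϖ * b := upperQuot_eq hϖ h (by rw [← mul_assoc, ← pow_succ, ← hb])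
  obtain ⟨h0, h1⟩ := residue_diag_eq_one hR hℓ h.2
  rw [twist_apply]
  convert map_one σ
  ext i j
  fin_cases i <;> fin_cases j <;>
    simp [coe_conjDiag, hu, h0, h1, hϖ0, Nat.one_le_iff_ne_zero.1 hℓ]

/-- After conjugation and reduction `h` is upper unipotent, and both operations negate its upper
right entry. -/
theorem twist_conjSign {ϖ : R} (hϖ : Irreducible ϖ) {ℓ : ℕ} (hℓ : 1 ≤ ℓ)
    (hR : Nat.card (ResidueField R) = 2)
    (σ : Representation ℂ (SpecialLinearGroup (Fin 2) (ResidueField R)) V) (h : lowerBorel R ℓ) :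
    twist hϖ ℓ σ ⟨conjSign R h, (conjSign_mem_lowerBorel _).2 h.2⟩ = twist hϖ ℓ σ h⁻¹ := by
  have hu : upperQuot hϖ (⟨conjSign R h, (conjSign_mem_lowerBorel _).2 h.2⟩ : lowerBorel R ℓ) =
      -upperQuot hϖ h := by
    apply upperQuot_eq
    rw [mul_neg, ← pow_mul_upperQuot]
    rfl
  obtain ⟨h0, h1⟩ := residue_diag_eq_one hR hℓ h.2
  rw [twist_apply, twist_apply, map_inv]
  congr 1
  ext i j
  fin_cases i <;> fin_cases j <;>
    simp [coe_conjDiag, hu, h0, h1, coe_conjSign, Matrix.adjugate_fin_two]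

/-- Lower triangular matrices lie in every `B'_ℓ`, and an upper unipotent `s` is inverted by a
change of sign of its parameter. -/
theorem exists_eq_mul_mul_of_conjSign {ℓ : ℕ} (g : SpecialLinearGroup (Fin 2) R) :
    ∃ (h₁ h₂ : lowerBorel R ℓ) (s : SpecialLinearGroup (Fin 2) R),
      conjSign R s = s⁻¹ ∧ g = h₁ * s * h₂ := by
  obtain ⟨h₁, h₂, x, hh₁, hh₂, rfl⟩ := exists_eq_lower_mul_upper_mul_lower g
  refine ⟨⟨h₁, by simp [mem_lowerBorel, hh₁]⟩, ⟨h₂, by simp [mem_lowerBorel, hh₂]⟩, _, ?_, rfl⟩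
  ext i j
  fin_cases i <;> fin_cases j <;>
    simp [coe_conjSign, Matrix.adjugate_fin_two]

theorem mackeyComponent_multiplicityFree [TopologicalSpace R] [IsTopologicalRing R]
    [CompactSpace R] [T2Space R] (hR : Nat.card (ResidueField R) = 2) {ϖ : R}
    (hϖ : Irreducible ϖ) {σ : Representation ℂ (SpecialLinearGroup (Fin 2) (ResidueField R)) V}
    (hσ : IsCuspidal σ) {ℓ : ℕ} (hℓ : 1 ≤ ℓ) :
    IsMultiplicityFree (mackeyComponent hϖ ℓ σ) ∧
    Module.Finite ℂ (Representation.IntertwiningMap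
      (mackeyComponent hϖ ℓ σ) (mackeyComponent hϖ ℓ σ)) ∧
    (∀ S T : Representation.IntertwiningMap
      (mackeyComponent hϖ ℓ σ) (mackeyComponent hϖ ℓ σ), S * T = T * S) ∧
    IsSumOfDistinctIrreducibles (mackeyComponent hϖ ℓ σ)
      (selfIntertwiningNumber (mackeyComponent hϖ ℓ σ)) := by
  have hV := hσ.finrank_eq_one hR
  have : FiniteDimensional ℂ V := FiniteDimensional.of_finrank_eq_succ hV
  have := finiteIndex_lowerBorel R ℓ
  have := finiteIndex_lowerBorel R (ℓ + 1)
  have hle := lowerBorel_anti R ℓ.le_succ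
  -- The open, finite-index subgroup `B'_(ℓ+1)`, on which the character is trivial, supplies both
  -- semisimplicity and automatic local constancy.
  have hone := twist_eq_one hϖ hℓ hR σ
  have := finiteDimensional_smoothIndSpace (τ := twist hϖ ℓ σ)
  have : Representation.IsSemisimpleRepresentation (mackeyComponent hϖ ℓ σ) :=
    isSemisimpleRepresentation_smoothInd hle hone
  have hcomm : ∀ S T : Representation.IntertwiningMap
      (mackeyComponent hϖ ℓ σ) (mackeyComponent hϖ ℓ σ), S * T = T * S :=
    smoothInd_endomorphisms_commute hV
      (fun _ => isLocallyConstant_of_equivariant _ (isOpen_lowerBorel R (ℓ + 1)) hle hone)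
      (conjSign R) conjSign_mem_lowerBorel (twist_conjSign hϖ hℓ hR σ)
      exists_eq_mul_mul_of_conjSign
  exact ⟨fun _ _ _ τ hτ => rank_intertwiningMap_le_one hcomm τ hτ, inferInstance, hcomm,
    isSumOfDistinctIrreducibles_of_commute _ hcomm⟩

end LowerBorel

end MackeySL2

theorem corollary6p3
    (F : Type*) [Field F] [ValuativeRel F] [TopologicalSpace F] [IsNonarchimedeanLocalField F]
    (hF : Nat.card (IsLocalRing.ResidueField (ValuativeRel.valuation F).integer) = 2)
    (ϖ : (ValuativeRel.valuation F).integer) (hϖ : Irreducible ϖ)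
    (V : Type*) [AddCommGroup V] [Module ℂ V]
    (σ : Representation ℂ (Matrix.SpecialLinearGroup (Fin 2)
      (IsLocalRing.ResidueField (ValuativeRel.valuation F).integer)) V)
    (hσ : MackeySL2.IsCuspidal σ)
    (ℓ : ℕ) (hℓ : 1 ≤ ℓ) :
    MackeySL2.IsMultiplicityFree (MackeySL2.mackeyComponent hϖ ℓ σ) ∧
    Module.Finite ℂ (Representation.IntertwiningMap
      (MackeySL2.mackeyComponent hϖ ℓ σ) (MackeySL2.mackeyComponent hϖ ℓ σ)) ∧
    (∀ S T : Representation.IntertwiningMap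
      (MackeySL2.mackeyComponent hϖ ℓ σ) (MackeySL2.mackeyComponent hϖ ℓ σ), S * T = T * S) ∧
    MackeySL2.IsSumOfDistinctIrreducibles (MackeySL2.mackeyComponent hϖ ℓ σ)
      (MackeySL2.selfIntertwiningNumber (MackeySL2.mackeyComponent hϖ ℓ σ)) := by
  -- Separation and compactness of the ring of integers enter through the openness of the powers of
  -- its maximal ideal.
  have : T2Space F :=
    letI := IsTopologicalAddGroup.rightUniformSpace F
    haveI := isUniformAddGroup_of_addCommGroup (G := F)
    inferInstance
  have : CompactSpace (ValuativeRel.valuation F).integer := inferInstance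
  exact MackeySL2.mackeyComponent_multiplicityFree hF hϖ hσ hℓ
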